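/- Let $K,N,N_r,K_c$ be positive integers with $N_r\le N$, $N\mid K$ and $K_c\le K$, and let $M=\frac KN(N-N_r+1)$. Consider the following distributed linearly separable computation problem. There are $K$ messages $W_1,\dots,W_K$, each a row vector of $L\ge 1$ symbols of a finite field $\mathbb F_q$, and a request matrix $\mathbf F\in\mathbb F_q^{K_c\times K}$; all entries of the messages and of $\mathbf F$ are independent and uniform on $\mathbb F_q$. A scheme assigns to each worker $n\in\{1,\dots,N\}$ a set $\mathcal Z_n\subseteq\{1,\dots,K\}$ with $|\mathcal Z_n|\le M$ (possibly depending on $\mathbf F$); worker $n$ sends $X_n=\psi_n((W_k)_{k\in\mathcal Z_n},\mathbf F)\in\mathbb F_q^{T_n}$, and for every set $\mathcal A$ of $N_r$ workers the master forms an estimate $\phi_{\mathcal A}((X_n)_{n\in\mathcal A},\mathbf F)$ of $\mathbf F\,[W_1;\dots;W_K]\in\mathbb F_q^{K_c\times L}$, where the functions $\psi_n,\phi_{\mathcal A}$ are arbitrary. The worst-case error probability is $$\varepsilon_q=\max_{|\mathcal A|=N_r}\Pr\bigl\{\phi_{\mathcal A}((X_n)_{n\in\mathcal A},\mathbf F)\ne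 \mathbf F[W_1;\dots;W_K]\bigr\},$$ and the communication cost is $R=\max_{|\mathcal A|=N_r}\frac1L\sum_{n\in\mathcal A}T_n$. The cost $R$ is achievable under the cyclic assignment if there are $L\ge1$ and $T_1,\dots,T_N\ge 0$, not depending on $q$, with cost $R$, and for every prime power $q$ a scheme over $\mathbb F_q$ with these parameters and with $$\mathcal Z_n=\bigcup_{p=0}^{K/N-1}\{\mathrm{Mod}(n+i,N)+pN:\ 0\le i\le N-N_r\}\qquad(1\le n\le N),$$ where $\mathrm{Mod}(b,N)\in\{1,\dots,N\}$ is the residue of $b$ modulo $N$, such that $\varepsilon_q\to0$ as $q\to\infty$ through the prime powers. Then there is a smallest communication cost $C_{\rm cyc}$ that is achievable under the cyclic assignment, and $$C_{\rm cyc}=R_{\rm ach}:=\begin{cases}N_rK_c,&1\le K_c<\frac KN,\\[2pt] \frac KN N_r,&\frac KN\le K_c\le\frac KN N_r,\\[2pt] K_c,&\frac KN N_r<K_c\le K.\end{cases}$$ -/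

import Mathlib

open scoped NNReal

namespace LinSep

/-- A computation scheme, over the finite field `𝔽`, for `K` datasets, `N` workers, a
request matrix with `Kc` rows and computation cost at most `M`, where each message consists of `L`
symbols of `𝔽` and worker `n` sends `T n` symbols.  Datasets and workers are numbered from `0`.
The data assignment, the encoding functions and the decoding functions may all depend on the
request matrix `F`; they are otherwise arbitrary (in particular not assumed to be linear). -/
structure Scheme (𝔽 : Type) (K N Kc M L : ℕ) (T : Fin N → ℕ) where
  /-- the set of datasets assigned to worker `n` -/
  assign : Fin N → Matrix (Fin Kc) (Fin K) 𝔽 → Finset (Fin K)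
  /-- no worker holds more than `M` datasets -/
  card_assign_le : ∀ n F, (assign n F).card ≤ M
  /-- the answer of worker `n`, a function of the messages of its own datasets and of `F` -/
  encode : ∀ (n : Fin N) (F : Matrix (Fin Kc) (Fin K) 𝔽),
    (assign n F → Fin L → 𝔽) → Fin (T n) → 𝔽
  /-- the output of the master, given the answers of the workers in `A` and `F` -/
  decode : ∀ A : Finset (Fin N), (∀ n : A, Fin (T n) → 𝔽) → Matrix (Fin Kc) (Fin K) 𝔽 →
    Matrix (Fin Kc) (Fin L) 𝔽

namespace Scheme

variable {𝔽 : Type} {K N Kc M L : ℕ} {T : Fin N → ℕ}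

/-- The answer of worker `n` when the request matrix is `F` and the messages are the rows
of `W`. -/
def answer (S : Scheme 𝔽 K N Kc M L T) (F : Matrix (Fin Kc) (Fin K) 𝔽)
    (W : Matrix (Fin K) (Fin L) 𝔽) (n : Fin N) : Fin (T n) → 𝔽 :=
  S.encode n F fun k => W k.1

/-- What the master computes from the answers of the workers in `A`. -/
def output (S : Scheme 𝔽 K N Kc M L T) (A : Finset (Fin N)) (F : Matrix (Fin Kc) (Fin K) 𝔽)
    (W : Matrix (Fin K) (Fin L) 𝔽) : Matrix (Fin Kc) (Fin L) 𝔽 :=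
  S.decode A (fun n => S.answer F W n.1) F

/-- The probability that the master does not recover `F * W` from the answers of the workers
in `A`, when all entries of `F` and `W` are independent and uniform on the finite field `𝔽`. -/
noncomputable def errorProb [Field 𝔽] (S : Scheme 𝔽 K N Kc M L T) (A : Finset (Fin N)) : ℝ≥0 :=
  (Nat.card {x : Matrix (Fin Kc) (Fin K) 𝔽 × Matrix (Fin K) (Fin L) 𝔽 //
      S.output A x.1 x.2 ≠ x.1 * x.2} : ℝ≥0) /
    (Nat.card (Matrix (Fin Kc) (Fin K) 𝔽 × Matrix (Fin K) (Fin L) 𝔽) : ℝ≥0)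

/-- The worst-case probability of error over all sets of `Nr` responding workers. -/
noncomputable def worstError [Field 𝔽] (S : Scheme 𝔽 K N Kc M L T) (Nr : ℕ) : ℝ≥0 :=
  (Finset.powersetCard Nr (Finset.univ : Finset (Fin N))).sup fun A => S.errorProb A

end Scheme

/-- The communication cost: the maximal number of symbols sent by `Nr` workers, divided by the
length `L` of a message. -/
def commCost {N : ℕ} (Nr L : ℕ) (T : Fin N → ℕ) : ℚ :=
  ((Finset.powersetCard Nr (Finset.univ : Finset (Fin N))).sup fun A => ∑ n ∈ A, T n : ℕ) / (L : ℚ)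

/-- The cyclic assignment: worker `n` holds the datasets `((n + i) mod N) + p N` for
`0 ≤ i ≤ N - Nr` and `0 ≤ p < K / N` (everything numbered from `0`). -/
def cyclicAssignment (K N Nr : ℕ) (n : Fin N) : Finset (Fin K) :=
  Finset.univ.filter fun k => ∃ p < K / N, ∃ i ≤ N - Nr,
    k.val = (n.val + i) % N + p * N

/-- `R` is an achievable communication cost under the cyclic assignment: there are a message
length `L`, answer lengths `T`, of cost `R`, and a scheme over each finite field that uses the
cyclic assignment, whose worst-case error probability tends to `0` as the order of the field tends
to infinity. -/
def AchievableCyclic (K N Nr Kc M : ℕ) (R : ℚ) : Prop :=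
  ∃ (L : ℕ) (T : Fin N → ℕ), 0 < L ∧ commCost Nr L T = R ∧
    ∃ S : ∀ (𝔽 : Type) [Field 𝔽] [Finite 𝔽], Scheme 𝔽 K N Kc M L T,
      (∀ (𝔽 : Type) [Field 𝔽] [Finite 𝔽] (n : Fin N) (F : Matrix (Fin Kc) (Fin K) 𝔽),
        (S 𝔽).assign n F = cyclicAssignment K N Nr n) ∧
      ∀ δ : ℝ≥0, 0 < δ → ∃ Q : ℕ, ∀ (𝔽 : Type) [Field 𝔽] [Finite 𝔽],
        Q ≤ Nat.card 𝔽 → (S 𝔽).worstError Nr ≤ δ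

/-- The communication cost of the three regimes. -/
def Rach (K N Nr Kc : ℕ) : ℚ :=
  if Kc < K / N then (Nr * Kc : ℕ)
  else if Kc ≤ K / N * Nr then (K / N * Nr : ℕ)
  else (Kc : ℕ)

end LinSep

/-! ### Generic properties of matrices over large finite fields -/

namespace LinSep

/-! Write `m = K / N`; the datasets congruent to `c` modulo `N` form the class `c`, of size `m`.

Converse. Among the workers `n, …, n + Nr - 1` only `n` holds the class `n`, and `min Kc m` columns
of this class are generically independent, so `n` alone must send `min Kc m * L` symbols. Likewise
any `Nr` workers together must send `Kc * L` symbols. Both bounds come from one counting argument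
(`Scheme.card_success_le`, `mul_le_sum_of_error_le`), which needs no linearity: with too few
symbols, successful pairs with an invertible request block have proportion at most `1 / q`.

Achievability rests on `generic_decodable`, for a request with exactly `Nr * m` rows. Worker `n`
lacks `Nr - 1` classes, hence `(Nr - 1) * m` columns, so some `m` combinations of the rows avoid
them; adjugates give these polynomially in the entries. For `Nr` workers the combinations form a
square matrix, whose determinant must be a nonzero polynomial. It is tested on a request where the
rows of each worker already avoid the classes it lacks: the square matrix then becomes diagonal up
to nonzero factors, provided certain minors do not vanish, and `exists_matching` exhibits a
permutation matrix among their specializations. Schwartz–Zippel concludes.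

The other sizes reduce to this one. If `m ≤ Kc ≤ Nr * m`, the request is padded with virtual rows.
If `Kc < m`, each class is compressed to `Kc` virtual datasets. If `Kc > Nr * m`, messages of length
`Nr * m` are coded by a Vandermonde matrix over the cyclic windows of `Nr * m` rows. -/

/-- The proportion of the elements of a finite type that lie in a set. -/
noncomputable def density {X : Type} (S : Set X) : ℝ≥0 := (Nat.card S : ℝ≥0) / Nat.card X

lemma density_mono {X : Type} [Finite X] {S S' : Set X} (h : S ⊆ S') :
    density S ≤ density S' := by
  unfold density
  gcongr
  exact Nat.card_mono (Set.toFinite S') h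

lemma density_union_le {X : Type} (S S' : Set X) :
    density (S ∪ S') ≤ density S + density S' := by
  unfold density
  rw [← add_div]
  gcongr
  exact_mod_cast Set.ncard_union_le S S'

lemma density_univ {X : Type} [Finite X] [Nonempty X] : density (Set.univ : Set X) = 1 := by
  unfold density
  rw [Nat.card_univ, div_self]
  exact_mod_cast Nat.card_pos.ne'

/-- The density of the preimage of a set under the first projection. -/
lemma density_preimage_fst {X Y : Type} [Finite Y] [Nonempty Y] (S : Set X) :
    density (Prod.fst ⁻¹' S : Set (X × Y)) = density S := by
  have e : (Prod.fst ⁻¹' S : Set (X × Y)) = S ×ˢ Set.univ := by ext; simp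
  have hy : (Nat.card Y : ℝ≥0) ≠ 0 := by exact_mod_cast Nat.card_pos.ne'
  unfold density
  rw [e, Nat.card_prod, Nat.card_congr (Equiv.Set.prod S Set.univ), Nat.card_prod, Nat.card_univ]
  push_cast
  rw [mul_div_mul_right _ _ hy]

lemma density_preimage_equiv {X Y : Type} (e : X ≃ Y) (S : Set Y) :
    density (e ⁻¹' S) = density S := by
  unfold density
  rw [Nat.card_congr e]
  congr 2
  exact Nat.card_congr (e.subtypeEquiv fun x => Iff.rfl)

/-- The coordinates outside the range of `f` are free, so they split off as a factor of a product.
-/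
lemma density_preimage_comp {𝔽 σ τ : Type} [Finite 𝔽] [Nonempty 𝔽] [Finite σ] {f : τ → σ}
    (hf : Function.Injective f) (S : Set (τ → 𝔽)) :
    density {x : σ → 𝔽 | x ∘ f ∈ S} = density S := by
  classical
  let e : (σ → 𝔽) ≃ (τ → 𝔽) × ({s // s ∉ Set.range f} → 𝔽) :=
    ((Equiv.piEquivPiSubtypeProd (fun s => s ∈ Set.range f) fun _ => 𝔽)).trans
      (Equiv.prodCongr ((Equiv.ofInjective f hf).arrowCongr (Equiv.refl 𝔽)).symm (Equiv.refl _))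
  rw [← density_preimage_fst (Y := {s // s ∉ Set.range f} → 𝔽) S, ← density_preimage_equiv e]
  rfl

lemma density_preimage_submatrix {𝔽 ρ ρ' κ κ' : Type} [Finite 𝔽] [Nonempty 𝔽] [Finite ρ]
    [Finite κ] {f : ρ' → ρ} {g : κ' → κ} (hf : Function.Injective f) (hg : Function.Injective g)
    (S : Set (Matrix ρ' κ' 𝔽)) :
    density {F : Matrix ρ κ 𝔽 | F.submatrix f g ∈ S} = density S := by
  have h := density_preimage_comp (𝔽 := 𝔽) (hf.prodMap hg)
    {x : ρ' × κ' → 𝔽 | (Matrix.of fun i j => x (i, j)) ∈ S}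
  have e := density_preimage_equiv (Equiv.curry ρ' κ' 𝔽) S
  have e' := density_preimage_equiv (Equiv.curry ρ κ 𝔽) {F | Matrix.submatrix F f g ∈ S}
  exact e'.symm.trans (h.trans e)

/-- A property of matrices over finite fields is generic if the proportion of the matrices that
fail to have it tends to `0` as the order of the field tends to infinity. -/
def Generic {ρ κ : Type} (P : ∀ (𝔽 : Type) [Field 𝔽] [Finite 𝔽], Matrix ρ κ 𝔽 → Prop) : Prop :=
  ∀ δ : ℝ≥0, 0 < δ → ∃ Q : ℕ, ∀ (𝔽 : Type) [Field 𝔽] [Finite 𝔽], Q ≤ Nat.card 𝔽 →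
    density {F : Matrix ρ κ 𝔽 | ¬ P 𝔽 F} ≤ δ

namespace Generic

variable {ρ ρ' κ κ' : Type} {P P' : ∀ (𝔽 : Type) [Field 𝔽] [Finite 𝔽], Matrix ρ κ 𝔽 → Prop}

lemma and [Finite ρ] [Finite κ] (h : Generic P) (h' : Generic P') :
    Generic fun 𝔽 _ _ F => P 𝔽 F ∧ P' 𝔽 F := by
  intro δ hδ
  obtain ⟨Q, hQ⟩ := h (δ / 2) (by positivity)
  obtain ⟨Q', hQ'⟩ := h' (δ / 2) (by positivity)
  refine ⟨max Q Q', fun 𝔽 _ _ hq => ?_⟩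
  calc _ ≤ density ({F : Matrix ρ κ 𝔽 | ¬ P 𝔽 F} ∪ {F : Matrix ρ κ 𝔽 | ¬ P' 𝔽 F}) := by
        apply density_mono
        intro F hF
        exact not_and_or.1 hF
    _ ≤ _ := density_union_le _ _
    _ ≤ δ / 2 + δ / 2 := add_le_add (hQ 𝔽 (le_of_max_le_left hq)) (hQ' 𝔽 (le_of_max_le_right hq))
    _ = δ := add_halves δ

lemma forall_mem [Finite ρ] [Finite κ] {ι : Type} (s : Finset ι)
    {P : ι → ∀ (𝔽 : Type) [Field 𝔽] [Finite 𝔽], Matrix ρ κ 𝔽 → Prop}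
    (h : ∀ i ∈ s, Generic (P i)) : Generic fun 𝔽 _ _ F => ∀ i ∈ s, P i 𝔽 F := by
  classical
  induction s using Finset.induction_on with
  | empty =>
    intro δ _
    exact ⟨0, fun 𝔽 _ _ _ => by simp [density]⟩
  | insert a s _ ih =>
    simp only [Finset.forall_mem_insert] at h ⊢
    exact h.1.and (ih h.2)

lemma forall_fintype [Finite ρ] [Finite κ] {ι : Type} [Fintype ι]
    {P : ι → ∀ (𝔽 : Type) [Field 𝔽] [Finite 𝔽], Matrix ρ κ 𝔽 → Prop}
    (h : ∀ i, Generic (P i)) : Generic fun 𝔽 _ _ F => ∀ i, P i 𝔽 F := by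
  simpa using forall_mem Finset.univ fun i _ => h i

/-- A generic property of a submatrix is a generic property of the matrix. -/
lemma submatrix [Finite ρ] [Finite κ] {f : ρ' → ρ} {g : κ' → κ} (hf : Function.Injective f)
    (hg : Function.Injective g)
    {P : ∀ (𝔽 : Type) [Field 𝔽] [Finite 𝔽], Matrix ρ' κ' 𝔽 → Prop} (h : Generic P) :
    Generic fun 𝔽 _ _ (F : Matrix ρ κ 𝔽) => P 𝔽 (F.submatrix f g) := by
  intro δ hδ
  obtain ⟨Q, hQ⟩ := h δ hδ
  refine ⟨Q, fun 𝔽 _ _ hq => le_of_eq_of_le ?_ (hQ 𝔽 hq)⟩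
  exact density_preimage_submatrix hf hg {F | ¬ P 𝔽 F}

/-- A generic matrix extends to a matrix with a given generic property. -/
lemma exists_extension [Finite ρ] [Finite κ] {f : ρ' → ρ} {g : κ' → κ}
    (hf : Function.Injective f) (hg : Function.Injective g) (h : Generic P) :
    Generic fun 𝔽 _ _ (F : Matrix ρ' κ' 𝔽) => ∃ G : Matrix ρ κ 𝔽, P 𝔽 G ∧ G.submatrix f g = F := by
  intro δ hδ
  obtain ⟨Q, hQ⟩ := h δ hδ
  refine ⟨Q, fun 𝔽 _ _ hq => le_trans ?_ (hQ 𝔽 hq)⟩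
  rw [← density_preimage_submatrix hf hg]
  refine density_mono fun G hG hP => hG ⟨G, hP, rfl⟩

/-- Over large fields there are matrices with a given generic property. -/
lemma exists_of_large [Finite ρ] [Finite κ] (h : Generic P) :
    ∃ Q : ℕ, ∀ (𝔽 : Type) [Field 𝔽] [Finite 𝔽], Q ≤ Nat.card 𝔽 → ∃ F, P 𝔽 F := by
  obtain ⟨Q, hQ⟩ := h (1 / 2) (by positivity)
  refine ⟨Q, fun 𝔽 _ _ hq => ?_⟩
  by_contra! hF
  have h1 := hQ 𝔽 hq
  have e : {F : Matrix ρ κ 𝔽 | ¬ P 𝔽 F} = Set.univ := by ext F; simp [hF F]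
  rw [e, density_univ, ← NNReal.coe_le_coe] at h1
  norm_num at h1

/-- Generic properties only matter over large fields. -/
lemma mono_of_large [Finite ρ] [Finite κ] (h : Generic P) (Q₀ : ℕ)
    (hP : ∀ (𝔽 : Type) [Field 𝔽] [Finite 𝔽], Q₀ ≤ Nat.card 𝔽 → ∀ F, P 𝔽 F → P' 𝔽 F) :
    Generic P' := by
  intro δ hδ
  obtain ⟨Q, hQ⟩ := h δ hδ
  refine ⟨max Q Q₀, fun 𝔽 _ _ hq => le_trans ?_ (hQ 𝔽 (le_of_max_le_left hq))⟩
  exact density_mono fun F hF hF' => hF (hP 𝔽 (le_of_max_le_right hq) F hF')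

end Generic

/-! ### Nonvanishing of integral polynomials is generic -/

/-- A form of the Schwartz-Zippel lemma: the proportion of the zeros of an integral polynomial is
at most its degree divided by the order of the field, unless it vanishes identically. -/
lemma density_zeros_le {σ 𝔽 : Type} [Finite σ] [Field 𝔽] [Finite 𝔽] (p : MvPolynomial σ ℤ)
    (hp : MvPolynomial.map (Int.castRingHom 𝔽) p ≠ 0) :
    density {x : σ → 𝔽 | MvPolynomial.aeval x p = 0} ≤ (p.totalDegree : ℝ≥0) / Nat.card 𝔽 := by
  classical
  have := Fintype.ofFinite 𝔽
  obtain ⟨n, ⟨e⟩⟩ := Finite.exists_equiv_fin σ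
  set p' := MvPolynomial.rename e (MvPolynomial.map (Int.castRingHom 𝔽) p) with hp'
  have h0 : p' ≠ 0 := by
    rw [hp', Ne, ← map_zero (MvPolynomial.rename (R := 𝔽) e)]
    exact fun h => hp (MvPolynomial.rename_injective e e.injective h)
  have hdeg : p'.totalDegree ≤ p.totalDegree := by
    refine (MvPolynomial.totalDegree_rename_le _ _).trans ?_
    exact Finset.sup_mono (MvPolynomial.support_map_subset _ _)
  have hsz := MvPolynomial.schwartz_zippel_totalDegree h0 (Finset.univ : Finset 𝔽)
  have hcard : density {x : σ → 𝔽 | MvPolynomial.aeval x p = 0} =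
      density {x : Fin n → 𝔽 | MvPolynomial.eval x p' = 0} := by
    rw [← density_preimage_equiv (e.arrowCongr (Equiv.refl 𝔽))]
    congr 1
    ext x
    simp only [Set.mem_ofPred_eq, Set.mem_preimage, hp', MvPolynomial.eval_rename,
      MvPolynomial.eval_map, MvPolynomial.aeval_def]
    have : (e.arrowCongr (Equiv.refl 𝔽)) x ∘ e = x := by ext i; simp [Equiv.arrowCongr]
    rw [this]
    rfl
  rw [hcard]
  have h1 : density {x : Fin n → 𝔽 | MvPolynomial.eval x p' = 0} ≤
      (p'.totalDegree : ℝ≥0) / Nat.card 𝔽 := by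
    unfold density
    have := (NNRat.cast_le (K := ℝ≥0)).2 hsz
    simp only [Fintype.piFinset_univ, Finset.card_univ] at this
    push_cast at this
    simpa [Nat.card_eq_fintype_card, Fintype.card_subtype] using this
  refine h1.trans ?_
  gcongr

/-- The locus where an integral polynomial does not vanish is generic, if the polynomial is nonzero
over every field. -/
lemma Generic.of_polynomial {ρ κ : Type} [Finite ρ] [Finite κ] (p : MvPolynomial (ρ × κ) ℤ)
    (hp : ∀ (𝔽 : Type) [Field 𝔽] [Finite 𝔽], MvPolynomial.map (Int.castRingHom 𝔽) p ≠ 0)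
    {P : ∀ (𝔽 : Type) [Field 𝔽] [Finite 𝔽], Matrix ρ κ 𝔽 → Prop}
    (hP : ∀ (𝔽 : Type) [Field 𝔽] [Finite 𝔽] (F : Matrix ρ κ 𝔽),
      MvPolynomial.aeval (fun i : ρ × κ => F i.1 i.2) p ≠ 0 → P 𝔽 F) : Generic P := by
  intro δ hδ
  obtain ⟨Q, hQ⟩ := exists_nat_ge ((p.totalDegree : ℝ≥0) / δ)
  refine ⟨Q, fun 𝔽 _ _ hq => ?_⟩
  have hq0 : (0 : ℝ≥0) < Nat.card 𝔽 := by exact_mod_cast Nat.card_pos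
  calc _ ≤ density {F : Matrix ρ κ 𝔽 | MvPolynomial.aeval (fun i : ρ × κ => F i.1 i.2) p = 0} :=
        density_mono fun F hF => by
          by_contra h
          exact hF (hP 𝔽 F h)
    _ = density {x : ρ × κ → 𝔽 | MvPolynomial.aeval x p = 0} :=
        (density_preimage_equiv (Equiv.curry ρ κ 𝔽)
          {F | MvPolynomial.aeval (fun i : ρ × κ => F i.1 i.2) p = 0}).symm
    _ ≤ (p.totalDegree : ℝ≥0) / Nat.card 𝔽 := density_zeros_le p (hp 𝔽)
    _ ≤ δ := by
      rw [div_le_iff₀ hq0]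
      rw [div_le_iff₀ hδ] at hQ
      refine hQ.trans ?_
      rw [mul_comm]
      gcongr

/-- A polynomial does not vanish over a field if it has a nonzero value in some algebra. -/
lemma map_ne_zero_of_aeval_ne_zero {σ 𝔽 D : Type} [Field 𝔽] [CommRing D] [Algebra 𝔽 D]
    (p : MvPolynomial σ ℤ) (x : σ → D) (h : MvPolynomial.aeval x p ≠ 0) :
    MvPolynomial.map (Int.castRingHom 𝔽) p ≠ 0 := by
  intro h0
  apply h
  have := congrArg (MvPolynomial.aeval (R := 𝔽) x) h0
  rw [MvPolynomial.aeval_def, MvPolynomial.eval₂_map, map_zero] at this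
  rw [MvPolynomial.aeval_def, ← this]
  congr 1
  exact RingHom.ext_int _ _

/-- Square submatrices of generic matrices are invertible. -/
lemma generic_det_submatrix {ρ κ δ : Type} [Finite ρ] [Finite κ] [Fintype δ] [DecidableEq δ]
    {f : δ → ρ} {g : δ → κ} (hf : Function.Injective f) (hg : Function.Injective g) :
    Generic fun 𝔽 _ _ (F : Matrix ρ κ 𝔽) => (F.submatrix f g).det ≠ 0 := by
  refine Generic.submatrix hf hg (P := fun 𝔽 _ _ (F : Matrix δ δ 𝔽) => F.det ≠ 0) ?_
  refine Generic.of_polynomial (Matrix.det (Matrix.mvPolynomialX δ δ ℤ)) (fun 𝔽 _ _ => ?_)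
    fun 𝔽 _ _ F hF => ?_
  · apply map_ne_zero_of_aeval_ne_zero (D := 𝔽) _ fun i => (1 : Matrix δ δ 𝔽) i.1 i.2
    rw [AlgHom.map_det, Matrix.mvPolynomialX_mapMatrix_aeval, Matrix.det_one]
    exact one_ne_zero
  · rwa [AlgHom.map_det, Matrix.mvPolynomialX_mapMatrix_aeval] at hF

end LinSep

/-! ### Combinatorics of the cyclic assignment -/

namespace LinSep

variable {N : ℕ}

/-- Worker `n` holds the datasets of class `c`, that is, the datasets congruent to `c` modulo `N`,
under the cyclic assignment. -/
def Holds (Nr : ℕ) (n c : Fin N) : Prop := ∃ i ≤ N - Nr, c.val = (n.val + i) % N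

/-- The class `n - j` modulo `N`. -/
def back (n : Fin N) (j : ℕ) : Fin N := ⟨(n.val + (N - j)) % N, Nat.mod_lt _ n.pos⟩

/-- How far the class `c` is from `n` in the cyclic order. -/
def gap (n c : Fin N) : ℕ := (c.val + (N - n.val)) % N

lemma gap_lt (n c : Fin N) : gap n c < N := Nat.mod_lt _ n.pos

lemma gap_eq (n c : Fin N) :
    (n.val ≤ c.val ∧ gap n c = c.val - n.val) ∨ (c.val < n.val ∧ gap n c = c.val + N - n.val) := by
  unfold gap
  have := n.2
  have := c.2
  rcases le_or_gt n.val c.val with h | h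
  · left
    refine ⟨h, ?_⟩
    rw [show c.val + (N - n.val) = (c.val - n.val) + N by omega, Nat.add_mod_right,
      Nat.mod_eq_of_lt (by omega)]
  · right
    refine ⟨h, ?_⟩
    rw [Nat.mod_eq_of_lt (by omega)]
    omega

lemma back_eq (n : Fin N) (j : ℕ) (hj : j ≤ N) :
    (j ≤ n.val ∧ (back n j).val = n.val - j) ∨ (n.val < j ∧ (back n j).val = n.val + N - j) := by
  unfold back
  have := n.2
  rcases le_or_gt j n.val with h | h
  · left
    refine ⟨h, ?_⟩
    simp only
    rw [show n.val + (N - j) = (n.val - j) + N by omega, Nat.add_mod_right,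
      Nat.mod_eq_of_lt (by omega)]
  · right
    refine ⟨h, ?_⟩
    simp only
    rw [Nat.mod_eq_of_lt (by omega)]
    omega

lemma gap_injective (n : Fin N) : Function.Injective (gap n) := by
  intro c c' h
  apply Fin.ext
  have := c.2
  have := c'.2
  have := n.2
  rcases gap_eq n c with h1 | h1 <;> rcases gap_eq n c' with h2 | h2 <;> omega

lemma holds_iff_gap {Nr : ℕ} (hNr : 1 ≤ Nr) (hN : Nr ≤ N) (n c : Fin N) :
    Holds Nr n c ↔ gap n c ≤ N - Nr := by
  have hc := c.2
  have hn := n.2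
  constructor
  · rintro ⟨i, hi, h⟩
    rcases Nat.lt_or_ge (n.val + i) N with h3 | h3
    · rw [Nat.mod_eq_of_lt h3] at h
      rcases gap_eq n c with h1 | h1 <;> omega
    · rw [Nat.mod_eq_sub_mod h3, Nat.mod_eq_of_lt (by omega)] at h
      rcases gap_eq n c with h1 | h1 <;> omega
  · intro h
    refine ⟨gap n c, h, ?_⟩
    rcases gap_eq n c with h1 | h1
    · rw [Nat.mod_eq_of_lt (by omega)]
      omega
    · rw [show n.val + gap n c = c.val + N by omega, Nat.add_mod_right, Nat.mod_eq_of_lt hc]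

/-- Worker `n` holds `n, …, n + (N - Nr)`, so the classes it lacks are the `Nr - 1` classes just
before `n`. -/
lemma exists_back_of_not_holds {Nr : ℕ} (hNr : 1 ≤ Nr) (hN : Nr ≤ N) {n c : Fin N}
    (h : ¬ Holds Nr n c) : ∃ j : Fin Nr, j.val ≠ 0 ∧ c = back n j := by
  rw [holds_iff_gap hNr hN] at h
  have hc := c.2
  have hn := n.2
  have hg := gap_lt n c
  refine ⟨⟨N - gap n c, by omega⟩, by simp only; omega, Fin.ext ?_⟩
  rcases gap_eq n c with h1 | h1 <;> rcases back_eq n (N - gap n c) (by omega) with h2 | h2 <;>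
    simp only <;> omega

lemma holds_back_iff {Nr : ℕ} (hNr : 1 ≤ Nr) (hN : Nr ≤ N) (n : Fin N) (j : Fin Nr) :
    Holds Nr n (back n j) ↔ j.val = 0 := by
  rw [holds_iff_gap hNr hN]
  have hn := n.2
  have hj := j.2
  rcases back_eq n j (by omega) with h2 | h2 <;> rcases gap_eq n (back n j) with h1 | h1 <;> omega

lemma back_injective {Nr : ℕ} (hN : Nr ≤ N) (n : Fin N) :
    Function.Injective fun j : Fin Nr => back n j := by
  intro j j' h
  have h := congrArg Fin.val h
  simp only at h
  have := n.2
  have := j.2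
  have := j'.2
  apply Fin.ext
  rcases back_eq n j (by omega) with h1 | h1 <;> rcases back_eq n j' (by omega) with h2 | h2 <;>
    omega

lemma back_zero (n : Fin N) : back n 0 = n := by
  apply Fin.ext
  simp [back, Nat.mod_eq_of_lt n.2]

lemma StrictMono.le_apply_fin {r : ℕ} {d : Fin r → ℕ} (hd : StrictMono d) (i : Fin r) :
    i.val ≤ d i := by
  obtain ⟨i, hi⟩ := i
  induction i with
  | zero => exact Nat.zero_le _
  | succ i ih =>
    exact (ih (by omega)).trans_lt (hd (show (⟨i, by omega⟩ : Fin r) < ⟨i + 1, hi⟩ by simp))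

/-- Reversing both the indices and the values turns this into the previous lower bound. -/
lemma StrictMono.apply_add_le {r B : ℕ} {d : Fin r → ℕ} (hd : StrictMono d) (hB : ∀ i, d i < B)
    (i : Fin r) : d i + r ≤ B + i := by
  have h : StrictMono fun j : Fin r => B - 1 - d j.rev := by
    intro j j' hj
    have h1 := hd (Fin.rev_lt_rev.2 hj)
    have h2 := hB j.rev
    simp only
    omega
  have h1 := StrictMono.le_apply_fin h i.rev
  have h2 := hB i
  simp only [Fin.rev_rev, Fin.val_rev] at h1
  omega

/-- Among any `Nr` workers including `n`, the class `n` and the classes not held by `n` can be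
matched with distinct workers holding them. -/
lemma exists_matching {Nr : ℕ} (hN : Nr ≤ N) (e : Fin Nr → Fin N)
    (he : Function.Injective e) (i₀ : Fin Nr) :
    ∃ p : Equiv.Perm (Fin Nr), ∀ j : Fin Nr, Holds Nr (e (p j)) (back (e i₀) j) := by
  have hNr : 1 ≤ Nr := i₀.pos
  have : NeZero Nr := ⟨by omega⟩
  set n := e i₀
  let d : Fin Nr → ℕ := fun i => gap n (e i)
  have hd : Function.Injective d := (gap_injective n).comp he
  let s := Tuple.sort d
  have hs : StrictMono (d ∘ s) :=
    (Tuple.monotone_sort d).strictMono_of_injective (hd.comp s.injective)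
  have hlow := fun i => StrictMono.le_apply_fin hs i
  have hup := fun i => StrictMono.apply_add_le hs (B := N) (fun i => gap_lt _ _) i
  -- With the workers sorted by their distance from `n`, class `n` goes to the nearest one, which is
  -- `n` itself, and class `n - j` to the one of rank `Nr - j`.
  refine ⟨(Equiv.neg (Fin Nr)).trans s, fun j => ?_⟩
  rw [holds_iff_gap hNr hN]
  simp only [Equiv.trans_apply, Equiv.neg_apply]
  have hl := hlow (-j)
  have hu := hup (-j)
  have hj := j.2
  have hjv : (-j).val = (Nr - j.val) % Nr := by rw [Fin.neg_def]
  by_cases h0 : j.val = 0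
  · have hj0 : j = 0 := Fin.ext (by simpa using h0)
    subst hj0
    obtain ⟨k, hk⟩ := s.surjective i₀
    have hk0 : d (s (-0)) ≤ d i₀ := by
      rw [← hk, neg_zero]
      exact hs.monotone (Fin.zero_le k)
    have hi₀ : d i₀ = 0 := by
      rcases gap_eq n n with h | h
      · exact h.2.trans (by omega)
      · omega
    have h1 : d (s (-0)) = d i₀ := by omega
    rw [hd h1, h0, back_zero]
    change d i₀ ≤ _
    omega
  -- The distance `d` of rank `Nr - j` satisfies `Nr - j ≤ d ≤ N - j`, so the class `n - j` lies `N
  -- - j - d ≤ N - Nr` steps after the worker `n + d`.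
  · rw [Nat.mod_eq_of_lt (by omega)] at hjv
    simp only [Function.comp] at hl hu
    change _ ≤ gap n (e (s (-j))) at hl
    change gap n (e (s (-j))) + _ ≤ _ at hu
    have hn := n.2
    have ha := (e (s (-j))).2
    have hb := back_eq n j (by omega)
    have hg := gap_eq n (e (s (-j)))
    have hg' := gap_eq (e (s (-j))) (back n j)
    omega

end LinSep

/-! ### Row combinations avoiding missing classes, and generic decodability -/

namespace LinSep

variable {N : ℕ}

section Stack

variable {r m : ℕ} [NeZero r] {R S : Type} [CommRing R] [CommRing S]

/-- The columns of `F` that belong to the classes `n, n - 1, …, n - (r - 1)`. -/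
def windowBlock (n : Fin N) (F : Matrix (Fin r × Fin m) (Fin N × Fin m) R) :
    Matrix (Fin r × Fin m) (Fin r × Fin m) R :=
  F.submatrix id fun j => (back n j.1, j.2)

/-- Combinations of the rows of `F` that vanish on the classes not held by worker `n`. -/
def workerRows (n : Fin N) (F : Matrix (Fin r × Fin m) (Fin N × Fin m) R) :
    Matrix (Fin m) (Fin r × Fin m) R :=
  (windowBlock n F).adjugate.submatrix (fun x => (0, x)) id

/-- The combinations of the rows of `F` used by `r` workers. -/
def stackedRows (e : Fin r → Fin N) (F : Matrix (Fin r × Fin m) (Fin N × Fin m) R) :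
    Matrix (Fin r × Fin m) (Fin r × Fin m) R :=
  Matrix.of fun i => workerRows (e i.1) F i.2

/-- Adjugates commute with ring homomorphisms. This allows the generic matrix to be specialized. -/
lemma stackedRows_map (φ : R →+* S) (e : Fin r → Fin N)
    (F : Matrix (Fin r × Fin m) (Fin N × Fin m) R) :
    stackedRows e (F.map φ) = (stackedRows e F).map φ := by
  ext i j
  have h := congrFun (congrFun (RingHom.map_adjugate φ (windowBlock (e i.1) F)) (0, i.2)) j
  exact h.symm

/-- The missing classes are the window positions `j ≠ 0`, where the rows of adjugate times block
indexed by `(0, x)` only meet off-diagonal entries of a scalar matrix. -/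
lemma workerRows_mul_apply (hN : r ≤ N) (n c : Fin N) (hc : ¬ Holds r n c)
    (F : Matrix (Fin r × Fin m) (Fin N × Fin m) R) (x y : Fin m) :
    (workerRows n F * F) x (c, y) = 0 := by
  obtain ⟨j, hj, rfl⟩ := exists_back_of_not_holds (NeZero.one_le) hN hc
  have h := congrFun (congrFun (Matrix.adjugate_mul (windowBlock n F)) (0, x)) (j, y)
  have hne : ((0 : Fin r), x) ≠ (j, y) := by
    intro h
    have h0 : 0 = j := (Prod.ext_iff.1 h).1
    exact hj (by rw [← h0]; rfl)
  rw [Matrix.smul_apply, Matrix.one_apply_ne hne, smul_zero] at h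
  exact h

/-- If the row of the `i`-th worker vanishes outside the classes it holds, then the combinations
used by this worker are multiples of its own rows. -/
lemma smul_stackedRows (e : Fin r → Fin N) (y : Fin r → Fin N → R) (hN : r ≤ N)
    (hy : ∀ i c, ¬ Holds r (e i) c → y i c = 0) (F : Matrix (Fin r × Fin m) (Fin N × Fin m) R)
    (hF : F = Matrix.of fun i c => if i.2 = c.2 then y i.1 c.1 else 0)
    (i : Fin r) (x : Fin m) (t : Fin r × Fin m) :
    y i (e i) * stackedRows e F (i, x) t =
      (windowBlock (e i) F).det * (1 : Matrix (Fin r × Fin m) (Fin r × Fin m) R) (i, x) t := by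
  set B := windowBlock (e i) F with hB
  -- In its own window the worker holds only the class at position `0`, so this row of `B` has at
  -- most one nonzero entry, and `B * B.adjugate` isolates one row of the adjugate.
  have hrow : B (i, x) = Pi.single ((0 : Fin r), x) (y i (e i)) := by
    funext j
    obtain ⟨j, z⟩ := j
    rw [hB, hF]
    simp only [windowBlock, Matrix.submatrix_apply, Matrix.of_apply, id, Pi.single_apply,
      Prod.mk.injEq]
    by_cases hj : j = 0
    · subst hj
      simp only [Fin.val_zero, back_zero, true_and, eq_comm (a := x)]
    · have : ¬ Holds r (e i) (back (e i) j) := by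
        rw [holds_back_iff NeZero.one_le hN]
        exact fun h => hj (Fin.ext (by simpa using h))
      simp [hy i _ this, hj]
  have h := congrFun (congrFun (Matrix.mul_adjugate B) (i, x)) t
  rw [Matrix.mul_apply, hrow] at h
  simp only [Pi.single_apply, ite_mul, zero_mul, Finset.sum_ite_eq', Finset.mem_univ, if_true] at h
  exact h

end Stack

open MvPolynomial in
/-- The determinant of the stacked rows of `r` distinct workers is a nonzero polynomial over every
field. -/
lemma exists_det_stackedRows_ne_zero {r m : ℕ} [NeZero r] (hN : r ≤ N) (e : Fin r → Fin N)
    (he : Function.Injective e) (𝔽 : Type) [Field 𝔽] :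
    ∃ F : Matrix (Fin r × Fin m) (Fin N × Fin m) (MvPolynomial (Fin r × Fin N) 𝔽),
      (stackedRows e F).det ≠ 0 := by
  classical
  -- The entries stay indeterminate because each window determinant is tested by its own
  -- specialization; in a domain the product of the determinants is then nonzero, even over a small
  -- field.
  let y : Fin r → Fin N → MvPolynomial (Fin r × Fin N) 𝔽 :=
    fun i c => if Holds r (e i) c then X (i, c) else 0
  have hy : ∀ i c, ¬ Holds r (e i) c → y i c = 0 := fun i c h => if_neg h
  let F : Matrix (Fin r × Fin m) (Fin N × Fin m) (MvPolynomial (Fin r × Fin N) 𝔽) :=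
    Matrix.of fun i c => if i.2 = c.2 then y i.1 c.1 else 0
  have hdet : ∀ i, (windowBlock (e i) F).det ≠ 0 := by
    intro i h0
    obtain ⟨p, hp⟩ := exists_matching hN e he i
    -- Keeping only the entries matched by `p` turns the window block into a permutation matrix.
    let φ : MvPolynomial (Fin r × Fin N) 𝔽 →+* 𝔽 :=
      (aeval fun a : Fin r × Fin N => if a.2 = back (e i) (p.symm a.1) then (1 : 𝔽) else 0).toRingHom
    have hφ : φ.mapMatrix (windowBlock (e i) F) =
        (1 : Matrix (Fin r × Fin m) (Fin r × Fin m) 𝔽).submatrix id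
          (Equiv.prodCongr p (Equiv.refl _)) := by
      ext ⟨k, x⟩ ⟨j, z⟩
      simp only [RingHom.mapMatrix_apply, Matrix.map_apply, windowBlock, Matrix.submatrix_apply, id,
        F, Matrix.of_apply, Matrix.one_apply, Equiv.prodCongr_apply, Prod.map, Equiv.refl_apply,
        Prod.mk.injEq, y]
      by_cases hx : x = z
      · by_cases hk : k = p j
        · subst hk
          simp [hx, hp j, φ]
        · have hne : back (e i) j ≠ back (e i) (p.symm k) := fun h => hk <| by
            rw [back_injective hN (e i) h, Equiv.apply_symm_apply]
          simp only [hx, hk, if_true, and_true, if_false]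
          split_ifs
          · simp [φ, hne]
          · exact map_zero φ
      · simp [hx]
    have h1 := congrArg φ h0
    rw [RingHom.map_det, hφ, Matrix.det_permute', Matrix.det_one, map_zero, mul_one] at h1
    rcases Int.units_eq_one_or (Equiv.Perm.sign (Equiv.prodCongr p (Equiv.refl (Fin m)))) with
      h | h <;> simp [h] at h1
  refine ⟨F, fun h0 => ?_⟩
  have h := smul_stackedRows e y hN hy F rfl
  have hmul : Matrix.diagonal (fun i : Fin r × Fin m => y i.1 (e i.1)) * stackedRows e F =
      Matrix.diagonal fun i : Fin r × Fin m => (windowBlock (e i.1) F).det := by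
    ext ⟨i, x⟩ t
    rw [Matrix.diagonal_mul, h, Matrix.one_apply, Matrix.diagonal_apply, mul_ite, mul_one, mul_zero]
  have hd := congrArg Matrix.det hmul
  rw [Matrix.det_mul, h0, mul_zero, Matrix.det_diagonal] at hd
  exact Finset.prod_ne_zero_iff.2 (fun i _ => hdet i.1) hd.symm

variable {𝔽 : Type} [Field 𝔽]

/-- A request matrix is decodable if every worker has `m` combinations of its rows that only
involve the datasets held by this worker, such that the combinations of any `Nr` workers
determine all rows. -/
def Decodable (Nr : ℕ) {m : ℕ} {ρ : Type} [Fintype ρ] (G : Matrix ρ (Fin N × Fin m) 𝔽) : Prop :=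
  ∃ U : Fin N → Matrix (Fin m) ρ 𝔽,
    (∀ n c x y, ¬ Holds Nr n c → (U n * G) x (c, y) = 0) ∧
    ∀ A : Finset (Fin N), A.card = Nr → ∀ v : ρ → 𝔽, (∀ n ∈ A, (U n).mulVec v = 0) → v = 0

/-- The combinations in `workerRows` decode as soon as finitely many determinants, one for each
choice of `Nr` workers in order, do not vanish. -/
theorem generic_decodable {Nr m : ℕ} (hNr : 1 ≤ Nr) (hN : Nr ≤ N) :
    Generic fun 𝔽 _ _ (G : Matrix (Fin Nr × Fin m) (Fin N × Fin m) 𝔽) => Decodable Nr G := by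
  have : NeZero Nr := ⟨by omega⟩
  have key : Generic fun 𝔽 _ _ (G : Matrix (Fin Nr × Fin m) (Fin N × Fin m) 𝔽) =>
      ∀ e : Fin Nr ↪ Fin N, (stackedRows e G).det ≠ 0 := by
    refine Generic.forall_fintype fun e => Generic.of_polynomial
      (stackedRows e (Matrix.mvPolynomialX (Fin Nr × Fin m) (Fin N × Fin m) ℤ)).det
      (fun 𝔽 _ _ => ?_) fun 𝔽 _ _ G hG => ?_
    · obtain ⟨F, hF⟩ := exists_det_stackedRows_ne_zero (m := m) hN e e.injective 𝔽
      apply map_ne_zero_of_aeval_ne_zero (D := MvPolynomial (Fin Nr × Fin N) 𝔽) _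
        fun i => F i.1 i.2
      rw [AlgHom.map_det]
      change ((stackedRows _ _).map (MvPolynomial.aeval _).toRingHom).det ≠ 0
      rw [← stackedRows_map]
      convert hF
      ext1 i j
      simp [Matrix.mvPolynomialX]
    · rw [AlgHom.map_det] at hG
      change ((stackedRows _ _).map (MvPolynomial.aeval _).toRingHom).det ≠ 0 at hG
      rw [← stackedRows_map] at hG
      convert hG
      ext1 i j
      simp [Matrix.mvPolynomialX]
  refine key.mono_of_large 0 fun 𝔽 _ _ _ G hG => ⟨fun n => workerRows n G,
    fun n c x y hc => workerRows_mul_apply hN n c hc G x y, fun A hA v hv => ?_⟩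
  let e := (A.orderEmbOfFin hA).toEmbedding
  apply Matrix.eq_zero_of_mulVec_eq_zero (hG e)
  ext i
  exact congrFun (hv (e i.1) (A.orderEmbOfFin_mem hA i.1)) i.2

end LinSep

/-! ### Converse: counting the pairs on which the master succeeds -/

namespace LinSep

section Scheme

variable {𝔽 : Type} {K N Kc M L : ℕ} {T : Fin N → ℕ}

lemma Scheme.answer_congr (S : Scheme 𝔽 K N Kc M L T) {F : Matrix (Fin Kc) (Fin K) 𝔽}
    {W W' : Matrix (Fin K) (Fin L) 𝔽} {n : Fin N} (h : ∀ k ∈ S.assign n F, W k = W' k) :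
    S.answer F W n = S.answer F W' n := by
  unfold answer
  congr 1
  funext k
  exact h k.1 k.2

lemma Scheme.output_congr (S : Scheme 𝔽 K N Kc M L T) {F : Matrix (Fin Kc) (Fin K) 𝔽}
    {W W' : Matrix (Fin K) (Fin L) 𝔽} {A : Finset (Fin N)}
    (h : ∀ n ∈ A, S.answer F W n = S.answer F W' n) : S.output A F W = S.output A F W' := by
  unfold output
  congr 1
  funext n
  exact h n.1 n.2

lemma Scheme.errorProb_eq_density [Field 𝔽] (S : Scheme 𝔽 K N Kc M L T) (A : Finset (Fin N)) :
    S.errorProb A = density {x : Matrix (Fin Kc) (Fin K) 𝔽 × Matrix (Fin K) (Fin L) 𝔽 |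
      S.output A x.1 x.2 ≠ x.1 * x.2} := rfl

/-- If only the workers in `B` hold the datasets in the range of `g`, then a pair of matrices for
which the master succeeds is determined, for nondegenerate requests, by the request, the answers of
the workers in `B` and the messages outside the range of `g`. -/
lemma Scheme.card_success_le [Field 𝔽] [Finite 𝔽] (S : Scheme 𝔽 K N Kc M L T)
    (A B : Finset (Fin N)) {d : ℕ} (f : Fin d → Fin Kc) {g : Fin d → Fin K}
    (hg : Function.Injective g)
    (hAB : ∀ F, ∀ n ∈ A, n ∉ B → ∀ i, g i ∉ S.assign n F) :
    Nat.card {x : Matrix (Fin Kc) (Fin K) 𝔽 × Matrix (Fin K) (Fin L) 𝔽 |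
      (x.1.submatrix f g).det ≠ 0 ∧ S.output A x.1 x.2 = x.1 * x.2} * Nat.card 𝔽 ^ (d * L) ≤
    Nat.card (Matrix (Fin Kc) (Fin K) 𝔽 × Matrix (Fin K) (Fin L) 𝔽) *
      Nat.card 𝔽 ^ (∑ n ∈ B, T n) := by
  classical
  let C := {x : Matrix (Fin Kc) (Fin K) 𝔽 × Matrix (Fin K) (Fin L) 𝔽 |
      (x.1.submatrix f g).det ≠ 0 ∧ S.output A x.1 x.2 = x.1 * x.2}
  let Φ : C → (Fin Kc → Fin K → 𝔽) × ((n : B) → Fin (T n.1) → 𝔽) ×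
      ({k // k ∉ Set.range g} → Fin L → 𝔽) :=
    fun x => (x.1.1, fun n => S.answer x.1.1 x.1.2 n.1, fun k => x.1.2 k.1)
  have hΦ : Function.Injective Φ := by
    rintro ⟨⟨F, W⟩, hdet, hW⟩ ⟨⟨F', W'⟩, hdet', hW'⟩ h
    obtain ⟨hF, h⟩ := Prod.ext_iff.1 h
    obtain ⟨hB, hk⟩ := Prod.ext_iff.1 h
    have hF : F = F' := hF
    subst hF
    have hout : S.output A F W = S.output A F W' := S.output_congr fun n hn => by
      by_cases hnB : n ∈ B
      · exact congrFun hB ⟨n, hnB⟩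
      · refine S.answer_congr fun k hk' => congrFun hk ⟨k, ?_⟩
        rintro ⟨i, rfl⟩
        exact hAB F n hn hnB i hk'
    have hprod : F * (W - W') = 0 := by
      rw [Matrix.mul_sub, sub_eq_zero]
      exact hW.symm.trans (hout.trans hW')
    have hzero : ∀ k, k ∉ Set.range g → ∀ l, (W - W') k l = 0 := fun k hk' l => by
      rw [Matrix.sub_apply, sub_eq_zero]
      exact congrFun (congrFun hk ⟨k, hk'⟩) l
    -- The difference of the messages is supported on the range of `g`, where the invertible block
    -- of the request detects it.
    have hsub : ∀ l, (F.submatrix f g).mulVec (fun i => (W - W') (g i) l) = 0 := fun l => by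
      ext i
      have h1 := congrFun (congrFun hprod (f i)) l
      rw [Matrix.mul_apply] at h1
      refine Eq.trans ?_ h1
      exact Fintype.sum_of_injective g hg _ _
        (fun k hk' => by simp only [hzero k hk' l, mul_zero]) fun _ => rfl
    have hWW : W = W' := by
      ext k l
      rw [← sub_eq_zero, ← Matrix.sub_apply]
      by_cases hk' : k ∈ Set.range g
      · obtain ⟨i, rfl⟩ := hk'
        exact congrFun (Matrix.eq_zero_of_mulVec_eq_zero hdet (hsub l)) i
      · exact hzero k hk' l
    subst hWW
    rfl
  have hcard := Nat.card_le_card_of_injective Φ hΦ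
  have hrest : Nat.card {k // k ∉ Set.range g} + d = K := by
    have h1 : Nat.card (Set.range g) = d := by
      rw [Nat.card_range_of_injective hg, Nat.card_eq_fintype_card, Fintype.card_fin]
    have h2 := Nat.card_congr (Equiv.sumCompl fun k => k ∈ Set.range g)
    rw [Nat.card_sum, Nat.card_eq_fintype_card (α := Fin K), Fintype.card_fin] at h2
    change Nat.card (Set.range g) + _ = _ at h2
    omega
  have hans : Nat.card ((n : B) → Fin (T n.1) → 𝔽) = Nat.card 𝔽 ^ (∑ n ∈ B, T n) := by
    rw [Nat.card_pi, ← Finset.prod_pow_eq_pow_sum, ← Finset.prod_coe_sort B]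
    simp [Nat.card_fun]
  have hmsg : Nat.card ({k // k ∉ Set.range g} → Fin L → 𝔽) =
      Nat.card 𝔽 ^ (L * Nat.card {k // k ∉ Set.range g}) := by
    rw [Nat.card_fun, Nat.card_fun, Nat.card_eq_fintype_card (α := Fin L), Fintype.card_fin,
      ← pow_mul]
  have h2 : Nat.card (Matrix (Fin K) (Fin L) 𝔽) = Nat.card 𝔽 ^ (L * K) := by
    change Nat.card (Fin K → Fin L → 𝔽) = _
    simp [Nat.card_fun, pow_mul]
  rw [Nat.card_prod, Nat.card_prod, hans, hmsg] at hcard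
  calc _ ≤ _ := Nat.mul_le_mul_right _ hcard
    _ = Nat.card (Fin Kc → Fin K → 𝔽) * Nat.card 𝔽 ^ (∑ n ∈ B, T n) *
        Nat.card 𝔽 ^ (L * (Nat.card {k // k ∉ Set.range g} + d)) := by ring
    _ = _ := by
      rw [hrest, Nat.card_prod, h2]
      change _ = Nat.card (Fin Kc → Fin K → 𝔽) * _ * _
      ring

end Scheme

/-- If only the workers in `B` among the responding workers `A` hold `d` given datasets, and `d`
is at most the number of requests, then the workers in `B` send at least `d * L` symbols. -/
theorem mul_le_sum_of_error_le {K N Nr Kc M L : ℕ} {T : Fin N → ℕ}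
    (S : ∀ (𝔽 : Type) [Field 𝔽] [Finite 𝔽], Scheme 𝔽 K N Kc M L T)
    (hS : ∀ δ : ℝ≥0, 0 < δ → ∃ Q : ℕ, ∀ (𝔽 : Type) [Field 𝔽] [Finite 𝔽],
        Q ≤ Nat.card 𝔽 → (S 𝔽).worstError Nr ≤ δ)
    {A B : Finset (Fin N)} (hA : A.card = Nr) {d : ℕ} (hd : d ≤ Kc) {g : Fin d → Fin K}
    (hg : Function.Injective g)
    (hAB : ∀ (𝔽 : Type) [Field 𝔽] [Finite 𝔽] (F : Matrix (Fin Kc) (Fin K) 𝔽), ∀ n ∈ A, n ∉ B →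
      ∀ i, g i ∉ (S 𝔽).assign n F) : d * L ≤ ∑ n ∈ B, T n := by
  by_contra! hlt
  let f := Fin.castLE hd
  have hf : Function.Injective f := Fin.castLE_injective hd
  -- Errors, degenerate requests and nondegenerate successes cover everything; each will have
  -- density at most `1 / 4`, which is absurd. The summand `4` below makes `1 / p ≤ 1 / 4`.
  obtain ⟨Q₁, hQ₁⟩ := hS (1 / 4) (by positivity)
  obtain ⟨Q₂, hQ₂⟩ := generic_det_submatrix hf hg (1 / 4) (by positivity)
  obtain ⟨p, hpQ, hp⟩ := Nat.exists_infinite_primes (Q₁ + Q₂ + 4)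
  have : Fact p.Prime := ⟨hp⟩
  have hcp : Nat.card (ZMod p) = p := Nat.card_zmod p
  have h1 := hQ₁ (ZMod p) (by omega)
  have h2 := hQ₂ (ZMod p) (by omega)
  set C := {x : Matrix (Fin Kc) (Fin K) (ZMod p) × Matrix (Fin K) (Fin L) (ZMod p) |
      (x.1.submatrix f g).det ≠ 0 ∧ (S (ZMod p)).output A x.1 x.2 = x.1 * x.2} with hC
  set E := {x : Matrix (Fin Kc) (Fin K) (ZMod p) × Matrix (Fin K) (Fin L) (ZMod p) |
      (S (ZMod p)).output A x.1 x.2 ≠ x.1 * x.2} with hE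
  set D : Set (Matrix (Fin Kc) (Fin K) (ZMod p) × Matrix (Fin K) (Fin L) (ZMod p)) :=
    Prod.fst ⁻¹' {F | ¬ (F.submatrix f g).det ≠ 0} with hD
  have h1' : density E ≤ 1 / 4 := by
    refine le_trans ?_ h1
    rw [hE, ← Scheme.errorProb_eq_density]
    exact Finset.le_sup (f := fun A => (S (ZMod p)).errorProb A)
      (Finset.mem_powersetCard.2 ⟨Finset.subset_univ _, hA⟩)
  have h2' : density D ≤ 1 / 4 := by
    rw [hD, density_preimage_fst]
    exact h2
  have h3 : density C ≤ 1 / 4 := by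
    have h := (S (ZMod p)).card_success_le A B f hg (hAB (ZMod p))
    rw [← hC, hcp] at h
    -- Even one missing symbol costs a factor `p`.
    have hpow : p * p ^ (∑ n ∈ B, T n) ≤ p ^ (d * L) := by
      rw [← pow_succ']
      exact Nat.pow_le_pow_right hp.pos hlt
    have h4 : Nat.card C * p ≤
        Nat.card (Matrix (Fin Kc) (Fin K) (ZMod p) × Matrix (Fin K) (Fin L) (ZMod p)) := by
      refine Nat.le_of_mul_le_mul_right (c := p ^ (∑ n ∈ B, T n)) ?_ (pow_pos hp.pos _)
      rw [mul_assoc]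
      exact (Nat.mul_le_mul_left _ hpow).trans h
    have h5 : Nat.card C * 4 ≤
        Nat.card (Matrix (Fin Kc) (Fin K) (ZMod p) × Matrix (Fin K) (Fin L) (ZMod p)) :=
      (Nat.mul_le_mul_left _ (by omega)).trans h4
    unfold density
    rw [div_le_div_iff₀ (by exact_mod_cast Nat.card_pos) (by positivity), one_mul]
    exact_mod_cast h5
  have hcover : Set.univ ⊆ E ∪ (D ∪ C) := by
    intro x _
    by_cases hx : x ∈ E
    · exact Or.inl hx
    · by_cases hx' : x ∈ D
      · exact Or.inr (Or.inl hx')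
      · exact Or.inr (Or.inr ⟨not_not.1 hx', not_not.1 hx⟩)
  have htot : (1 : ℝ≥0) ≤ 1 / 4 + (1 / 4 + 1 / 4) := by
    nth_rw 1 [← density_univ (X := Matrix (Fin Kc) (Fin K) (ZMod p) × Matrix (Fin K) (Fin L) (ZMod p))]
    refine (density_mono hcover).trans ((density_union_le _ _).trans ?_)
    exact add_le_add h1' ((density_union_le _ _).trans (add_le_add h2' h3))
  rw [← NNReal.coe_le_coe] at htot
  norm_num at htot

end LinSep

/-! ### From solvable requests to schemes -/

namespace LinSep

variable {K N Nr Kc M L m : ℕ}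

lemma card_cyclicAssignment_le (n : Fin N) :
    (cyclicAssignment K N Nr n).card ≤ K / N * (N - Nr + 1) := by
  have h : (cyclicAssignment K N Nr n).map Fin.valEmbedding ⊆
      (Finset.range (K / N) ×ˢ Finset.range (N - Nr + 1)).image
        fun x => (n.val + x.2) % N + x.1 * N := by
    intro k hk
    simp only [cyclicAssignment, Finset.mem_map, Finset.mem_filter, Finset.mem_univ, true_and] at hk
    obtain ⟨k, ⟨p, hp, i, hi, h⟩, rfl⟩ := hk
    simp only [Finset.mem_image, Finset.mem_product, Finset.mem_range]
    exact ⟨(p, i), ⟨hp, by simp only; omega⟩, h.symm⟩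
  rw [← Finset.card_map Fin.valEmbedding]
  refine (Finset.card_le_card h).trans (Finset.card_image_le.trans ?_)
  simp

/-- Datasets are indexed by their class and their position in the class. -/
def classEquiv (hK : K = m * N) : Fin K ≃ Fin N × Fin m :=
  (finCongr hK).trans (finProdFinEquiv.symm.trans (Equiv.prodComm _ _))

lemma classEquiv_fst_val (hK : K = m * N) (k : Fin K) :
    ((classEquiv hK k).1 : ℕ) = k.val % N := rfl

lemma mem_cyclicAssignment_iff (hK : K = m * N) (n : Fin N) (k : Fin K) :
    k ∈ cyclicAssignment K N Nr n ↔ Holds Nr n (classEquiv hK k).1 := by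
  have hN : 0 < N := n.pos
  have hm : K / N = m := by rw [hK, Nat.mul_div_cancel _ hN]
  simp only [cyclicAssignment, Finset.mem_filter, Finset.mem_univ, true_and, Holds,
    classEquiv_fst_val]
  constructor
  · rintro ⟨p, -, i, hi, h⟩
    exact ⟨i, hi, by rw [h, Nat.add_mul_mod_self_right, Nat.mod_mod]⟩
  · rintro ⟨i, hi, h⟩
    refine ⟨k / N, ?_, i, hi, ?_⟩
    · exact Nat.div_lt_div_of_lt_of_dvd ⟨m, by rw [hK, mul_comm]⟩ k.2
    · rw [← h, mul_comm]
      exact (Nat.mod_add_div _ _).symm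

lemma commCost_const (hN : Nr ≤ N) (L t : ℕ) :
    commCost Nr L (fun _ : Fin N => t) = ((Nr * t : ℕ) : ℚ) / L := by
  unfold commCost
  congr 2
  have h : ∀ A ∈ Finset.powersetCard Nr (Finset.univ : Finset (Fin N)), ∑ _n ∈ A, t = Nr * t :=
    fun A hA => by rw [Finset.sum_const, (Finset.mem_powersetCard.1 hA).2, smul_eq_mul]
  rw [Finset.sup_congr rfl h, Finset.sup_const]
  rw [Finset.powersetCard_nonempty]
  simpa using hN

section Solvable

variable {𝔽 : Type} [Field 𝔽]

/-- For the request matrix `F`, the workers can compute answers with entries indexed by `τ` from the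
datasets of the cyclic assignment such that any `Nr` answers determine the requested products. -/
def Solvable (N Nr L : ℕ) (τ : Type) (F : Matrix (Fin Kc) (Fin K) 𝔽) : Prop :=
  ∃ E : Fin N → Matrix (Fin K) (Fin L) 𝔽 → τ → 𝔽,
    (∀ n W W', (∀ k ∈ cyclicAssignment K N Nr n, W k = W' k) → E n W = E n W') ∧
    ∀ A : Finset (Fin N), A.card = Nr → ∀ W W', (∀ n ∈ A, E n W = E n W') → F * W = F * W'

open Classical in
/-- The answers of a solution of the request `F`, if there is one. -/
noncomputable def solverAnswer (N Nr L : ℕ) {τ : Type} (F : Matrix (Fin Kc) (Fin K) 𝔽)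
    (n : Fin N) (W : Matrix (Fin K) (Fin L) 𝔽) : τ → 𝔽 :=
  if h : Solvable N Nr L τ F then h.choose n W else 0

open Classical in
/-- The scheme that uses a solution of the request whenever there is one. -/
noncomputable def solverScheme (𝔽 : Type) [Field 𝔽] (K N Nr Kc M L : ℕ) {t : ℕ} {τ : Type}
    (e : Fin t ≃ τ) (hM : ∀ n, (cyclicAssignment K N Nr n).card ≤ M) :
    Scheme 𝔽 K N Kc M L (fun _ => t) where
  assign n _ := cyclicAssignment K N Nr n
  card_assign_le n _ := hM n
  encode n F w := solverAnswer (τ := τ) N Nr L F n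
    (fun k => if hk : k ∈ cyclicAssignment K N Nr n then w ⟨k, hk⟩ else 0) ∘ e
  decode A x F := if h : ∃ W, ∀ n : A, x n = solverAnswer (τ := τ) N Nr L F n.1 W ∘ e then
    F * h.choose else 0

/-- The master picks any messages `W'` consistent with the answers; they may differ from `W`, but
solvability forces `F * W' = F * W`. -/
lemma solverScheme_output {t : ℕ} {τ : Type} (e : Fin t ≃ τ)
    (hM : ∀ n, (cyclicAssignment K N Nr n).card ≤ M) (F : Matrix (Fin Kc) (Fin K) 𝔽)
    (hF : Solvable N Nr L τ F) (A : Finset (Fin N)) (hA : A.card = Nr)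
    (W : Matrix (Fin K) (Fin L) 𝔽) :
    (solverScheme 𝔽 K N Nr Kc M L e hM).output A F W = F * W := by
  have hsol : solverAnswer (τ := τ) N Nr L F = hF.choose := by
    funext n W
    exact dif_pos hF
  have hans : ∀ n, (solverScheme 𝔽 K N Nr Kc M L e hM).answer F W n =
      solverAnswer (τ := τ) N Nr L F n W ∘ e := by
    intro n
    change solverAnswer (τ := τ) N Nr L F n _ ∘ e = _
    rw [hsol]
    congr 1
    refine hF.choose_spec.1 n _ _ fun k hk => ?_
    simp [hk]
  have hex : ∃ W', ∀ n : A, (solverScheme 𝔽 K N Nr Kc M L e hM).answer F W n.1 =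
      solverAnswer (τ := τ) N Nr L F n.1 W' ∘ e := ⟨W, fun n => hans n⟩
  obtain ⟨W', hW', hout⟩ : ∃ W', (∀ n : A, (solverScheme 𝔽 K N Nr Kc M L e hM).answer F W n.1 =
      solverAnswer (τ := τ) N Nr L F n.1 W' ∘ e) ∧
      (solverScheme 𝔽 K N Nr Kc M L e hM).output A F W = F * W' :=
    ⟨hex.choose, hex.choose_spec, dif_pos hex⟩
  rw [hout]
  refine hF.choose_spec.2 A hA _ _ fun n hn => ?_
  have h1 := hW' ⟨n, hn⟩
  rw [hans, hsol] at h1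
  exact (e.surjective.injective_comp_right h1).symm

/-- Errors occur only at unsolvable requests, whatever the messages; there the default values are
harmless. -/
lemma solverScheme_worstError_le [Finite 𝔽] {t : ℕ} {τ : Type} (e : Fin t ≃ τ)
    (hM : ∀ n, (cyclicAssignment K N Nr n).card ≤ M) :
    (solverScheme 𝔽 K N Nr Kc M L e hM).worstError Nr ≤
      density {F : Matrix (Fin Kc) (Fin K) 𝔽 | ¬ Solvable N Nr L τ F} := by
  refine Finset.sup_le fun A hA => ?_
  rw [Scheme.errorProb_eq_density,
    ← density_preimage_fst (Y := Matrix (Fin K) (Fin L) 𝔽) {F | ¬ Solvable N Nr L τ F}]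
  exact density_mono fun x hx hF =>
    hx (solverScheme_output e hM x.1 hF A (Finset.mem_powersetCard.1 hA).2 x.2)

end Solvable

/-- If generic requests can be solved with messages of length `L` and answers of length `t`, then
the communication cost `Nr * t / L` is achievable. -/
theorem achievableCyclic_of_generic_solvable (hN : Nr ≤ N) (hL : 0 < L)
    (hM : M = K / N * (N - Nr + 1)) {τ : Type} [Fintype τ]
    (h : Generic fun 𝔽 _ _ (F : Matrix (Fin Kc) (Fin K) 𝔽) => Solvable N Nr L τ F) :
    AchievableCyclic K N Nr Kc M (((Nr * Fintype.card τ : ℕ) : ℚ) / L) := by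
  have hM' : ∀ n, (cyclicAssignment K N Nr n).card ≤ M :=
    fun n => (card_cyclicAssignment_le n).trans hM.ge
  refine ⟨L, fun _ => Fintype.card τ, hL, commCost_const hN _ _,
    fun 𝔽 _ _ => solverScheme 𝔽 K N Nr Kc M L (Fintype.equivFin τ).symm hM',
    fun 𝔽 _ _ n F => rfl, fun δ hδ => ?_⟩
  obtain ⟨Q, hQ⟩ := h δ hδ
  exact ⟨Q, fun 𝔽 _ _ hq => (solverScheme_worstError_le _ hM').trans (hQ 𝔽 hq)⟩

/-! ### From decodable matrices to solvable requests -/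

section Decodable

variable {𝔽 : Type} [Field 𝔽] {ρ : Type} [Fintype ρ]

/-- The combinations that decode `G` give answers computable from the held datasets, which determine
the product with `G`. -/
lemma Decodable.exists_answers {G : Matrix ρ (Fin N × Fin m) 𝔽} (hG : Decodable Nr G) :
    ∃ E : Fin N → (Fin N × Fin m → 𝔽) → Fin m → 𝔽,
      (∀ n v v', (∀ c y, Holds Nr n c → v (c, y) = v' (c, y)) → E n v = E n v') ∧
      ∀ A : Finset (Fin N), A.card = Nr → ∀ v v', (∀ n ∈ A, E n v = E n v') →
        G.mulVec v = G.mulVec v' := by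
  obtain ⟨U, hU, hdec⟩ := hG
  refine ⟨fun n v => (U n * G).mulVec v, fun n v v' h => ?_, fun A hA v v' h => ?_⟩
  · funext x
    refine Finset.sum_congr rfl fun c _ => ?_
    by_cases hc : Holds Nr n c.1
    · rw [h c.1 c.2 hc]
    · have h0 : (U n * G) x c = 0 := hU n c.1 x c.2 hc
      change (U n * G) x c * v c = (U n * G) x c * v' c
      rw [h0, zero_mul, zero_mul]
  · rw [← sub_eq_zero]
    refine hdec A hA _ fun n hn => ?_
    rw [Matrix.mulVec_sub, sub_eq_zero, Matrix.mulVec_mulVec, Matrix.mulVec_mulVec]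
    exact h n hn

/-- A request whose rows are among the rows of a decodable matrix is solvable. -/
lemma Decodable.solvable_submatrix (hK : K = m * N) {G : Matrix ρ (Fin N × Fin m) 𝔽}
    (hG : Decodable Nr G) (f : Fin Kc → ρ) :
    Solvable N Nr 1 (Fin m) (G.submatrix f (classEquiv hK)) := by
  obtain ⟨E, hE, hdec⟩ := hG.exists_answers
  have hmul : ∀ (W : Matrix (Fin K) (Fin 1) 𝔽) i l, (G.submatrix f (classEquiv hK) * W) i l =
      G.mulVec (fun c => W ((classEquiv hK).symm c) 0) (f i) := by
    intro W i l
    rw [Subsingleton.elim l 0, Matrix.mul_apply]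
    change _ = ∑ c, _
    rw [← Equiv.sum_comp (classEquiv hK)]
    simp
  refine ⟨fun n W => E n fun c => W ((classEquiv hK).symm c) 0, fun n W W' h => ?_,
    fun A hA W W' h => ?_⟩
  · refine hE n _ _ fun c y hc => congrFun (h _ ?_) 0
    rwa [mem_cyclicAssignment_iff hK, Equiv.apply_symm_apply]
  · ext i l
    rw [hmul, hmul, hdec A hA _ _ h]

/-- A request with few rows is solvable if a decodable matrix of smaller size exists whose blocks in
some rows are invertible. -/
lemma Decodable.solvable_of_det_ne_zero (hK : K = m * N) {G : Matrix ρ (Fin N × Fin Kc) 𝔽}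
    (hG : Decodable Nr G) (f : Fin Kc → ρ)
    (hdet : ∀ c : Fin N, (G.submatrix f fun y => (c, y)).det ≠ 0)
    (F : Matrix (Fin Kc) (Fin K) 𝔽) : Solvable N Nr 1 (Fin Kc) F := by
  classical
  obtain ⟨E, hE, hdec⟩ := hG.exists_answers
  let B : Fin N → Matrix (Fin Kc) (Fin Kc) 𝔽 := fun c => G.submatrix f fun y => (c, y)
  -- `z W c` is the contribution of class `c` to `F * W`. The virtual data `v` are chosen so that
  -- the rows `f` of `G` return the sum of these contributions.
  let z : Matrix (Fin K) (Fin 1) 𝔽 → Fin N → Fin Kc → 𝔽 := fun W c x =>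
    ∑ k, if (classEquiv hK k).1 = c then F x k * W k 0 else 0
  let v : Matrix (Fin K) (Fin 1) 𝔽 → Fin N × Fin Kc → 𝔽 := fun W c =>
    ((B c.1)⁻¹.mulVec (z W c.1)) c.2
  have hmul : ∀ (W : Matrix (Fin K) (Fin 1) 𝔽) i l, (F * W) i l = G.mulVec (v W) (f i) := by
    intro W i l
    rw [Subsingleton.elim l 0]
    have h1 : G.mulVec (v W) (f i) = ∑ c, ((B c).mulVec ((B c)⁻¹.mulVec (z W c))) i := by
      change ∑ c, _ = _
      rw [Fintype.sum_prod_type]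
      rfl
    have h2 : ∀ c, (B c).mulVec ((B c)⁻¹.mulVec (z W c)) = z W c := fun c => by
      rw [Matrix.mulVec_mulVec, Matrix.mul_nonsing_inv _ (isUnit_iff_ne_zero.2 (hdet c)),
        Matrix.one_mulVec]
    simp only [h1, h2, z]
    rw [Finset.sum_comm, Matrix.mul_apply]
    simp
  refine ⟨fun n W => E n (v W), fun n W W' h => ?_, fun A hA W W' h => ?_⟩
  · refine hE n _ _ fun c y hc => ?_
    have hz : z W c = z W' c := by
      funext x
      refine Finset.sum_congr rfl fun k _ => ?_
      split_ifs with hk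
      · rw [h k ((mem_cyclicAssignment_iff hK n k).2 (hk ▸ hc))]
      · rfl
    simp only [v, hz]
  · ext i l
    rw [hmul, hmul, hdec A hA _ _ h]

/-- The rows `j, j + 1, …` modulo `Kc`, as many as given by the product. -/
def cyclicRows [NeZero Kc] (h : Nr * m ≤ Kc) (j : Fin Kc) (t : Fin Nr × Fin m) : Fin Kc :=
  j + Fin.castLE h (finProdFinEquiv t)

lemma cyclicRows_injective [NeZero Kc] (h : Nr * m ≤ Kc) (j : Fin Kc) :
    Function.Injective (cyclicRows h j) := fun _ _ hab =>
  finProdFinEquiv.injective (Fin.castLE_injective h (add_left_cancel hab))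

/-- A request with many rows is solvable, by coding over the messages, if its blocks of cyclically
consecutive rows are decodable. -/
lemma solvable_of_forall_decodable [NeZero Kc] (hK : K = m * N) (hKc : Nr * m ≤ Kc)
    (F : Matrix (Fin Kc) (Fin K) 𝔽) (a : Fin Kc → 𝔽) (ha : Function.Injective a)
    (hF : ∀ j, Decodable Nr (F.submatrix (cyclicRows hKc j) (classEquiv hK).symm)) :
    Solvable N Nr (Nr * m) (Fin Kc × Fin m) F := by
  choose E hE hdec using fun j => (hF j).exists_answers
  -- The window starting at row `j` is requested for one combination of the message symbols, with
  -- coefficients the powers of `a j`.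
  let v : Matrix (Fin K) (Fin (Nr * m)) 𝔽 → Fin Kc → Fin N × Fin m → 𝔽 := fun W j c =>
    ∑ l : Fin (Nr * m), a j ^ (l : ℕ) * W ((classEquiv hK).symm c) l
  have hmul : ∀ W j t, (F.submatrix (cyclicRows hKc j) (classEquiv hK).symm).mulVec (v W j) t =
      ∑ l : Fin (Nr * m), a j ^ (l : ℕ) * (F * W) (cyclicRows hKc j t) l := by
    intro W j t
    change ∑ c, _ * ∑ l : Fin (Nr * m), _ = _
    simp only [Matrix.mul_apply, Finset.mul_sum, Matrix.submatrix_apply]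
    rw [Finset.sum_comm]
    refine Finset.sum_congr rfl fun l _ => ?_
    rw [← Equiv.sum_comp (classEquiv hK).symm]
    refine Finset.sum_congr rfl fun c _ => ?_
    ring
  refine ⟨fun n W jx => E jx.1 n (v W jx.1) jx.2, fun n W W' h => ?_, fun A hA W W' h => ?_⟩
  · funext ⟨j, x⟩
    refine congrFun (hE j n _ _ fun c y hc => ?_) x
    simp only [v]
    rw [h]
    rwa [mem_cyclicAssignment_iff hK, Equiv.apply_symm_apply]
  · have hj : ∀ j t, ∑ l : Fin (Nr * m), a j ^ (l : ℕ) * (F * W - F * W') (cyclicRows hKc j t) l = 0 := by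
      intro j t
      have h1 := congrFun (hdec j A hA (v W j) (v W' j) fun n hn => by
        funext x
        exact congrFun (h n hn) (j, x)) t
      rw [hmul, hmul] at h1
      simp only [Matrix.sub_apply, mul_sub, Finset.sum_sub_distrib, h1, sub_self]
    rw [← sub_eq_zero]
    ext i l
    -- Row `i` lies in the `Nr * m` windows starting at `i - b`; their distinct points give an
    -- invertible Vandermonde system for its `Nr * m` symbols.
    refine congrFun (Matrix.eq_zero_of_forall_index_sum_pow_mul_eq_zero
      (f := fun b : Fin (Nr * m) => a (i - Fin.castLE hKc b))
      (v := (F * W - F * W') i) (fun b b' hbb => ?_) fun b => ?_) l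
    · exact Fin.castLE_injective hKc (sub_right_injective (ha hbb))
    · have h1 := hj (i - Fin.castLE hKc b) (finProdFinEquiv.symm b)
      have h2 : cyclicRows hKc (i - Fin.castLE hKc b) (finProdFinEquiv.symm b) = i := by
        rw [cyclicRows, Equiv.apply_symm_apply, sub_add_cancel]
      rwa [h2] at h1

end Decodable

end LinSep

/-! ### The three regimes and the matching lower bounds -/

namespace LinSep

variable {K N Nr Kc M m : ℕ}

/-- One auxiliary matrix `G`, of class size `Kc` instead of `m`, serves every request over a large
field, so the error eventually vanishes. -/
lemma achievableCyclic_few_requests (hNr : 1 ≤ Nr) (hN : Nr ≤ N) (hK : K = m * N)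
    (hM : M = K / N * (N - Nr + 1)) : AchievableCyclic K N Nr Kc M ((Nr * Kc : ℕ) : ℚ) := by
  have : NeZero Nr := ⟨by omega⟩
  have h : Generic fun 𝔽 _ _ (F : Matrix (Fin Kc) (Fin K) 𝔽) => Solvable N Nr 1 (Fin Kc) F := by
    have hgen := (generic_decodable (m := Kc) hNr hN).and
      (Generic.forall_fintype fun c : Fin N => generic_det_submatrix
        (f := fun y : Fin Kc => ((0 : Fin Nr), y)) (g := fun y : Fin Kc => (c, y))
        (Prod.mk_right_injective _) (Prod.mk_right_injective _))
    obtain ⟨Q, hQ⟩ := hgen.exists_of_large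
    intro δ hδ
    refine ⟨Q, fun 𝔽 _ _ hq => ?_⟩
    obtain ⟨G, hG, hdet⟩ := hQ 𝔽 hq
    have he : {F : Matrix (Fin Kc) (Fin K) 𝔽 | ¬ Solvable N Nr 1 (Fin Kc) F} = ∅ :=
      Set.eq_empty_of_forall_notMem fun F hF => hF (hG.solvable_of_det_ne_zero hK _ hdet F)
    rw [he]
    simp [density]
  simpa using achievableCyclic_of_generic_solvable hN Nat.one_pos hM h

/-- A generic request is part of a decodable matrix with `Nr * m` rows; the added rows are decoded
and discarded. -/
lemma achievableCyclic_intermediate (hNr : 1 ≤ Nr) (hN : Nr ≤ N) (hK : K = m * N)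
    (hM : M = K / N * (N - Nr + 1)) (hKc : Kc ≤ Nr * m) :
    AchievableCyclic K N Nr Kc M ((Nr * m : ℕ) : ℚ) := by
  have h : Generic fun 𝔽 _ _ (F : Matrix (Fin Kc) (Fin K) 𝔽) => Solvable N Nr 1 (Fin m) F := by
    have hf : Function.Injective fun i : Fin Kc => finProdFinEquiv.symm (Fin.castLE hKc i) :=
      finProdFinEquiv.symm.injective.comp (Fin.castLE_injective hKc)
    refine ((generic_decodable (m := m) hNr hN).exists_extension hf
      (classEquiv hK).injective).mono_of_large 0 fun 𝔽 _ _ _ F hF => ?_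
    obtain ⟨G, hG, rfl⟩ := hF
    exact hG.solvable_submatrix hK _
  simpa using achievableCyclic_of_generic_solvable hN Nat.one_pos hM h

lemma achievableCyclic_many_requests (hNr : 1 ≤ Nr) (hN : Nr ≤ N) (hm : 1 ≤ m) (hK : K = m * N)
    (hM : M = K / N * (N - Nr + 1)) (hKc : Nr * m ≤ Kc) :
    AchievableCyclic K N Nr Kc M (Kc : ℚ) := by
  have hpos : 0 < Nr * m := Nat.mul_pos hNr hm
  have : NeZero Kc := ⟨by omega⟩
  have h : Generic fun 𝔽 _ _ (F : Matrix (Fin Kc) (Fin K) 𝔽) =>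
      Solvable N Nr (Nr * m) (Fin Kc × Fin m) F := by
    have hgen := Generic.forall_fintype fun j : Fin Kc =>
      (generic_decodable (m := m) hNr hN).submatrix (cyclicRows_injective hKc j)
        (classEquiv hK).symm.injective
    -- The field needs `Kc` distinct evaluation points, one per window.
    refine hgen.mono_of_large Kc fun 𝔽 _ _ hq F hF => ?_
    have := Fintype.ofFinite 𝔽
    obtain ⟨a⟩ : Nonempty (Fin Kc ↪ 𝔽) := by
      rw [Function.Embedding.nonempty_iff_card_le, Fintype.card_fin, ← Nat.card_eq_fintype_card]
      exact hq
    exact solvable_of_forall_decodable hK hKc F a a.injective hF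
  have h1 := achievableCyclic_of_generic_solvable hN hpos hM h
  convert h1 using 1
  rw [Fintype.card_prod, Fintype.card_fin, Fintype.card_fin, eq_div_iff (by positivity)]
  push_cast
  ring

/-- The workers `n, n + 1, …, n + (Nr - 1)` modulo `N`, of which only `n` holds the class `n`. -/
lemma exists_workers_not_holds (hNr : 1 ≤ Nr) (hN : Nr ≤ N) (n : Fin N) :
    ∃ A : Finset (Fin N), A.card = Nr ∧ ∀ n' ∈ A, n' ≠ n → ¬ Holds Nr n' n := by
  have hinj : Function.Injective fun j : Fin Nr =>
      (⟨(n.val + j) % N, Nat.mod_lt _ n.pos⟩ : Fin N) := by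
    intro j j' h
    have h1 : (n.val + j) % N = (n.val + j') % N := congrArg Fin.val h
    have h2 : j.val ≡ j'.val [MOD N] := Nat.ModEq.add_left_cancel' n.val h1
    exact Fin.ext (h2.eq_of_lt_of_lt (j.2.trans_le hN) (j'.2.trans_le hN))
  refine ⟨Finset.univ.map ⟨_, hinj⟩, by simp, fun n' hn' hne => ?_⟩
  obtain ⟨j, -, rfl⟩ := Finset.mem_map.1 hn'
  have hj := j.2
  have hn := n.2
  rw [holds_iff_gap hNr hN]
  have h0 : j.val ≠ 0 := fun h => hne (Fin.ext (by simp [h, Nat.mod_eq_of_lt hn]))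
  simp only [Function.Embedding.coeFn_mk]
  obtain ⟨a, ha⟩ : ∃ a : Fin N, a = ⟨(n.val + j) % N, Nat.mod_lt _ n.pos⟩ := ⟨_, rfl⟩
  have hav : a.val = (n.val + j) % N := by rw [ha]
  rw [← ha]
  -- For `0 < j < Nr` the class `n` comes `N - j > N - Nr` steps after the worker `n + j`, out of
  -- its reach.
  have hg := gap_eq a n
  rcases Nat.lt_or_ge (n.val + j) N with h | h
  · rw [Nat.mod_eq_of_lt h] at hav
    omega
  · rw [Nat.mod_eq_sub_mod h, Nat.mod_eq_of_lt (by omega)] at hav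
    omega

lemma sum_le_of_commCost {L : ℕ} {T : Fin N → ℕ} (hL : 0 < L) {b : ℕ} {A : Finset (Fin N)}
    (hA : A.card = Nr) (h : b * L ≤ ∑ n ∈ A, T n) : (b : ℚ) ≤ commCost Nr L T := by
  unfold commCost
  rw [le_div_iff₀ (by exact_mod_cast hL)]
  exact_mod_cast h.trans (Finset.le_sup (f := fun A => ∑ n ∈ A, T n)
    (Finset.mem_powersetCard.2 ⟨Finset.subset_univ _, hA⟩))

/-- The lower bounds on the communication cost: every worker sends at least
`L * min Kc (K / N)` symbols, and any `Nr` workers send at least `L * Kc` symbols. -/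
theorem le_of_achievableCyclic (hNr : 1 ≤ Nr) (hN : Nr ≤ N) (hK : K = m * N) (hKcK : Kc ≤ K)
    {R : ℚ} (h : AchievableCyclic K N Nr Kc M R) :
    ((Nr * min Kc m : ℕ) : ℚ) ≤ R ∧ (Kc : ℚ) ≤ R := by
  obtain ⟨L, T, hL, rfl, S, hassign, herr⟩ := h
  obtain ⟨A, -, hA⟩ := Finset.exists_subset_card_eq
    (s := (Finset.univ : Finset (Fin N))) (n := Nr) (by simpa using hN)
  refine ⟨sum_le_of_commCost hL hA ?_, sum_le_of_commCost hL hA ?_⟩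
  · have hT : ∀ n, min Kc m * L ≤ T n := by
      intro n
      obtain ⟨A', hA', hhold⟩ := exists_workers_not_holds hNr hN n
      have hg : Function.Injective fun i : Fin (min Kc m) =>
          (classEquiv hK).symm (n, Fin.castLE (min_le_right _ _) i) :=
        (classEquiv hK).symm.injective.comp
          ((Prod.mk_right_injective n).comp (Fin.castLE_injective _))
      -- All datasets in the range of `g` are in class `n`, so of the workers in `A'` only `n` can
      -- see them.
      have h1 := mul_le_sum_of_error_le S herr (B := {n}) hA' (min_le_left _ _) hg
        fun 𝔽 _ _ F n' hn' hne i => by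
          rw [hassign, mem_cyclicAssignment_iff hK, Equiv.apply_symm_apply]
          exact hhold n' hn' (by simpa using hne)
      simpa using h1
    calc Nr * min Kc m * L = ∑ _n ∈ A, min Kc m * L := by
          rw [Finset.sum_const, hA, smul_eq_mul, mul_assoc]
      _ ≤ ∑ n ∈ A, T n := Finset.sum_le_sum fun n _ => hT n
  · exact mul_le_sum_of_error_le S herr hA le_rfl (Fin.castLE_injective hKcK)
      fun 𝔽 _ _ F n hn hne => absurd hn hne

end LinSep

theorem theorem4 (K N Nr Kc M : ℕ) (hNr : 1 ≤ Nr) (hNrN : Nr ≤ N) (hNK : N ∣ K)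
    (hKc : 1 ≤ Kc) (hKcK : Kc ≤ K) (hM : M = K / N * (N - Nr + 1)) :
    IsLeast {R : ℚ | LinSep.AchievableCyclic K N Nr Kc M R} (LinSep.Rach K N Nr Kc) := by
  have hK : K = K / N * N := (Nat.div_mul_cancel hNK).symm
  have hm : 1 ≤ K / N := Nat.div_pos (Nat.le_of_dvd (by omega) hNK) (by omega)
  unfold LinSep.Rach
  constructor
  · change LinSep.AchievableCyclic K N Nr Kc M _
    split_ifs with h1 h2
    · exact LinSep.achievableCyclic_few_requests hNr hNrN hK hM
    · rw [mul_comm (K / N)] at h2 ⊢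
      exact LinSep.achievableCyclic_intermediate hNr hNrN hK hM h2
    · exact LinSep.achievableCyclic_many_requests hNr hNrN hm hK hM (by rw [mul_comm]; omega)
  · intro R hR
    obtain ⟨h3, h4⟩ := LinSep.le_of_achievableCyclic hNr hNrN hK hKcK hR
    split_ifs with h1 h2
    · rwa [min_eq_left h1.le] at h3
    · rwa [min_eq_right (by omega), mul_comm] at h3
    · exact h4
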